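/- Let $G=(V,E)$ be a finite simple undirected graph. Write $\alpha(G)$ for the maximum size of an independent set of $G$ and $\mu(G)$ for the maximum size of a matching of $G$; a finite graph $H$ is a König–Egerváry graph if $\alpha(H)+\mu(H)=|V(H)|$. Let $\eta(G)$ be the number of $\alpha$-critical edges of $G$, i.e. of edges $e\in E$ with $\alpha(G)<\alpha(G-e)$, and let $\varrho_v(G)$ be the number of vertices $v\in V$ such that $G-v$ is a König–Egerváry graph. For $A\subseteq V$ let $N(A)$ be the set of vertices having a neighbour in $A$ and let $d(A)=|A|-|N(A)|$; an independent set $A$ is critical if $d(A)=\max\{d(X):X\subseteq V\}$. Let $\ker(G)$ be the intersection of all critical independent sets of $G$ and $\varepsilon(G)=|\ker(G)|$. If $G$ is a König–Egerváry graph, then $$\eta(G)+\mu(G)+\varepsilon(G)\le\varrho_v(G)\le 2\mu(G)+\varepsilon(G),$$ and both of these inequalities are equalities (simultaneously) if and only if $\eta(G)=\mu(G)$. -/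

import Mathlib

namespace KonigEgervary

/-- The matching number `μ(G)`: the largest number of edges of a matching of `G`. -/
noncomputable def matchingNum {V : Type*} (G : SimpleGraph V) : ℕ :=
  sSup {n : ℕ | ∃ M : G.Subgraph, M.IsMatching ∧ M.edgeSet.ncard = n}

/-- `G` is a König–Egerváry graph: `α(G) + μ(G) = |V(G)|`. -/
def IsKonigEgervary {V : Type*} (G : SimpleGraph V) : Prop :=
  G.indepNum + matchingNum G = Nat.card V

/-- The vertex-deleted subgraph `G - v`. -/
def deleteVert {V : Type*} (G : SimpleGraph V) (v : V) : SimpleGraph ({v}ᶜ : Set V) :=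
  G.induce ({v}ᶜ : Set V)

/-- `ϱ_v(G)`: the number of vertices `v` such that `G - v` is a König–Egerváry graph. -/
noncomputable def rhoV {V : Type*} (G : SimpleGraph V) : ℕ :=
  {v : V | IsKonigEgervary (deleteVert G v)}.ncard

/-- The edge `e` is `α`-critical: `α(G) < α(G - e)`. -/
def IsAlphaCritical {V : Type*} (G : SimpleGraph V) (e : Sym2 V) : Prop :=
  e ∈ G.edgeSet ∧ G.indepNum < (G.deleteEdges {e}).indepNum

/-- `η(G)`: the number of `α`-critical edges. -/
noncomputable def eta {V : Type*} (G : SimpleGraph V) : ℕ :=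
  {e : Sym2 V | IsAlphaCritical G e}.ncard

/-- The neighborhood `N(A)` of a set of vertices. -/
def nbhd {V : Type*} (G : SimpleGraph V) (A : Set V) : Set V :=
  {v : V | (G.neighborSet v ∩ A).Nonempty}

/-- The difference `d(A) = |A| - |N(A)|`, as an integer. -/
noncomputable def diff {V : Type*} (G : SimpleGraph V) (A : Set V) : ℤ :=
  (A.ncard : ℤ) - ((nbhd G A).ncard : ℤ)

/-- The critical difference `d(G)`: the maximum of `d(A)` over all sets `A` of vertices. -/
noncomputable def critDiff {V : Type*} (G : SimpleGraph V) : ℤ :=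
  sSup (Set.range (diff G))

/-- `A` is a critical independent set. -/
def IsCriticalIndep {V : Type*} (G : SimpleGraph V) (A : Set V) : Prop :=
  G.IsIndepSet A ∧ diff G A = critDiff G

/-- `ker(G)`: the intersection of all critical independent sets. -/
def ker {V : Type*} (G : SimpleGraph V) : Set V :=
  ⋂₀ {A : Set V | IsCriticalIndep G A}

/-- `ε(G) = |ker(G)|`. -/
noncomputable def epsilon {V : Type*} (G : SimpleGraph V) : ℕ :=
  (ker G).ncard

end KonigEgervary

/-!
The argument compares the number of vertices `v` for which `G - v` is König–Egerváry with the size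
of `core G`, the intersection of the maximum independent sets. In every graph `|S| + |M| ≤ |V|` for
an independent set `S` and a matching `M`, and a König–Egerváry graph is one in which equality
occurs. All the steps rest on this duality.

* If `G` is König–Egerváry, then so is `G - v` exactly when `α` does not drop (`v` is outside the
  core) or `μ` does not drop (some maximum matching misses `v`);
  see `isKonigEgervary_deleteVert_iff_core`.
* The vertices missed by some maximum matching form `ker G` (`ker_eq_missable`). A critical
  independent set contains every vertex missed by a maximum matching, by counting. Conversely, if
  every maximum matching covers `v`, then Hall's theorem produces a critical independent set that
  avoids `v`. Since `ker G ⊆ core G`, it follows that `ϱ_v(G) = |V| - |core G| + ε(G)`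
  (`rhoV_add_ncard_core`).
* The `|V| - 2 μ(G) = α(G) - μ(G)` vertices missed by a maximum matching lie in the core, so
  `α(G) - |core G| ≤ μ(G)` (`indepNum_le_matchingNum_add_ncard_core`). This is the upper bound.
* An `α`-critical edge belongs to every maximum matching, its ends lie outside the core, and one of
  them lies in any given maximum independent set `S`. As edges of a matching are disjoint,
  `η(G) ≤ |S \ core G| = α(G) - |core G|` (`eta_add_ncard_core_le`). This is the lower bound.

Thus `η(G) ≤ α(G) - |core G| ≤ μ(G)`; the two bounds of the theorem are equalities exactly when
these two inequalities are, that is, when `η(G) = μ(G)`.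
-/

namespace KonigEgervary

open SimpleGraph

variable {V : Type*} {G : SimpleGraph V} {M : G.Subgraph} {S : Set V} {u v x y : V}

/-! ### Counting with matchings and independent sets -/

theorem ncard_verts_of_isMatching [Finite V] (hM : M.IsMatching) :
    M.verts.ncard = 2 * M.edgeSet.ncard := by
  classical
  have := Fintype.ofFinite V
  have h := M.spanningCoe.two_mul_card_edgeFinset
  have he : M.spanningCoe.edgeFinset.card = M.edgeSet.ncard := by
    rw [← Set.ncard_coe_finset, coe_edgeFinset, Subgraph.edgeSet_spanningCoe]
  rw [← he, h, Set.ncard_eq_toFinset_card']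
  symm
  refine Finset.card_bij (fun p _ => p.1) ?_ ?_ ?_
  · rintro ⟨a, b⟩ hab
    simpa using M.edge_vert (by simpa using hab)
  · rintro ⟨a, b⟩ hab ⟨c, d⟩ hcd (rfl : a = c)
    exact Prod.ext rfl (hM.eq_of_adj_left (by simpa using hab) (by simpa using hcd))
  · intro a ha
    obtain ⟨b, hb, -⟩ := hM (by simpa using ha)
    exact ⟨(a, b), by simpa using hb, rfl⟩

/-- A matching sends the vertices of a set injectively to their partners. -/
theorem ncard_inter_verts_le_of_isMatching [Finite V] (hM : M.IsMatching) {A B : Set V}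
    (h : ∀ a ∈ A, ∀ b, M.Adj a b → b ∈ B) : (A ∩ M.verts).ncard ≤ B.ncard := by
  have hp : ∀ a : V, ∃ b, a ∈ M.verts → M.Adj a b := fun a => by
    by_cases ha : a ∈ M.verts
    · obtain ⟨b, hb, -⟩ := hM ha
      exact ⟨b, fun _ => hb⟩
    · exact ⟨a, fun h => absurd h ha⟩
  choose p hp using hp
  refine Set.ncard_le_ncard_of_injOn p (fun a ha => h a ha.1 _ (hp a ha.2)) ?_
  intro a ha b hb hab
  exact hM.eq_of_adj_right (hp a ha.2) (hab ▸ hp b hb.2)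

/-- The weak duality `|S| + |M| ≤ |S ∪ V(M)|`, which needs only that no edge of the matching `M`
joins two vertices of `S`. -/
theorem ncard_add_ncard_edgeSet_le [Finite V] (hM : M.IsMatching)
    (h : ∀ a ∈ S, ∀ b ∈ S, ¬ M.Adj a b) :
    S.ncard + M.edgeSet.ncard ≤ (S ∪ M.verts).ncard := by
  have h1 : (S ∩ M.verts).ncard ≤ (M.verts \ S).ncard :=
    ncard_inter_verts_le_of_isMatching hM fun a ha b hab =>
      ⟨M.edge_vert hab.symm, fun hb => h a ha b hb hab⟩
  have h2 := Set.ncard_inter_add_ncard_sdiff_eq_ncard M.verts S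
  have h3 := ncard_verts_of_isMatching hM
  have h4 : (S ∪ M.verts).ncard = S.ncard + (M.verts \ S).ncard := by
    rw [← Set.union_sdiff_self, Set.ncard_union_eq Set.disjoint_sdiff_right]
  rw [Set.inter_comm] at h2
  omega

theorem exists_isMatching_deleteVerts_pair [Finite V] (hM : M.IsMatching)
    (hxy : M.Adj x y) :
    ∃ M' : G.Subgraph, M'.IsMatching ∧ M.edgeSet.ncard ≤ M'.edgeSet.ncard + 1 ∧
      x ∉ M'.verts ∧ y ∉ M'.verts := by
  have hM' : (M.deleteVerts {x, y}).IsMatching := by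
    rintro a ⟨ha, hane⟩
    obtain ⟨b, hb, -⟩ := hM ha
    have hbne : b ∉ ({x, y} : Set V) := by
      rintro (rfl | rfl)
      · exact hane (Or.inr (hM.eq_of_adj_left hb.symm hxy))
      · exact hane (Or.inl (hM.eq_of_adj_left hb.symm hxy.symm))
    refine ⟨b, Subgraph.deleteVerts_adj.2 ⟨ha, hane, M.edge_vert hb.symm, hbne, hb⟩, ?_⟩
    intro c hc
    exact hM.eq_of_adj_left (Subgraph.deleteVerts_adj.1 hc).2.2.2.2 hb
  refine ⟨_, hM', ?_, by simp, by simp⟩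
  have h1 := ncard_verts_of_isMatching hM
  have h2 := ncard_verts_of_isMatching hM'
  rw [Subgraph.deleteVerts_verts] at h2
  have h3 := Set.ncard_le_ncard_sdiff_add_ncard M.verts {x, y}
  rw [Set.ncard_pair hxy.ne] at h3
  omega

theorem exists_isMatching_notMem_verts [Finite V] (hM : M.IsMatching) (v : V) :
    ∃ M' : G.Subgraph, M'.IsMatching ∧ M.edgeSet.ncard ≤ M'.edgeSet.ncard + 1 ∧ v ∉ M'.verts := by
  by_cases hv : v ∈ M.verts
  · obtain ⟨w, hw, -⟩ := hM hv
    obtain ⟨M', h1, h2, h3, -⟩ := exists_isMatching_deleteVerts_pair hM hw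
    exact ⟨M', h1, h2, h3⟩
  · exact ⟨M, hM, by omega, hv⟩

theorem ncard_edgeSet_le_matchingNum [Finite V] (hM : M.IsMatching) :
    M.edgeSet.ncard ≤ matchingNum G := by
  refine le_csSup ⟨Nat.card (Sym2 V), ?_⟩ ⟨M, hM, rfl⟩
  rintro _ ⟨M', -, rfl⟩
  exact Set.ncard_le_card _

theorem exists_isMatching_ncard_eq_matchingNum [Finite V] (G : SimpleGraph V) :
    ∃ M : G.Subgraph, M.IsMatching ∧ M.edgeSet.ncard = matchingNum G := by
  refine Nat.sSup_mem (s := {n | ∃ M : G.Subgraph, M.IsMatching ∧ M.edgeSet.ncard = n})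
    ⟨_, ⊥, fun v hv => hv.elim, rfl⟩ ⟨Nat.card (Sym2 V), ?_⟩
  rintro _ ⟨M', -, rfl⟩
  exact Set.ncard_le_card _

theorem ncard_le_indepNum [Finite V] (hS : G.IsIndepSet S) : S.ncard ≤ G.indepNum := by
  have h : S.toFinite.toFinset.card ≤ G.indepNum :=
    IsIndepSet.card_le_indepNum (by simpa using hS)
  rwa [← Set.ncard_eq_toFinset_card S] at h

theorem exists_isIndepSet_ncard_eq_indepNum [Finite V] (G : SimpleGraph V) :
    ∃ S : Set V, G.IsIndepSet S ∧ S.ncard = G.indepNum := by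
  obtain ⟨s, hs⟩ := G.exists_isNIndepSet_indepNum
  exact ⟨s, hs.isIndepSet, by rw [Set.ncard_coe_finset, hs.card_eq]⟩

theorem not_adj_of_isIndepSet (hS : G.IsIndepSet S) : ∀ a ∈ S, ∀ b ∈ S, ¬ G.Adj a b :=
  fun _ ha _ hb h => hS ha hb h.ne h

theorem isIndepSet_of_not_adj (h : ∀ a ∈ S, ∀ b ∈ S, ¬ G.Adj a b) : G.IsIndepSet S :=
  fun _ ha _ hb _ => h _ ha _ hb

theorem ncard_add_ncard_edgeSet_le_of_isIndepSet [Finite V] (hS : G.IsIndepSet S)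
    (hM : M.IsMatching) : S.ncard + M.edgeSet.ncard ≤ (S ∪ M.verts).ncard :=
  ncard_add_ncard_edgeSet_le hM fun a ha b hb hab => not_adj_of_isIndepSet hS a ha b hb hab.adj_sub

theorem isKonigEgervary_iff [Finite V] : IsKonigEgervary G ↔
    ∃ (S : Set V) (M : G.Subgraph), G.IsIndepSet S ∧ M.IsMatching ∧
      Nat.card V ≤ S.ncard + M.edgeSet.ncard := by
  obtain ⟨S, hS, hSc⟩ := exists_isIndepSet_ncard_eq_indepNum G
  obtain ⟨M, hM, hMc⟩ := exists_isMatching_ncard_eq_matchingNum G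
  have h1 := (ncard_add_ncard_edgeSet_le_of_isIndepSet hS hM).trans (Set.ncard_le_card _)
  unfold IsKonigEgervary
  constructor
  · intro h
    exact ⟨S, M, hS, hM, by omega⟩
  · rintro ⟨S', M', hS', hM', h⟩
    have := ncard_le_indepNum hS'
    have := ncard_edgeSet_le_matchingNum hM'
    omega

/-! ### Vertex deletion -/

theorem isKonigEgervary_deleteVert_iff [Finite V] : IsKonigEgervary (deleteVert G v) ↔
    ∃ (S : Set V) (M : G.Subgraph), G.IsIndepSet S ∧ M.IsMatching ∧ v ∉ S ∧ v ∉ M.verts ∧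
      Nat.card V ≤ S.ncard + M.edgeSet.ncard + 1 := by
  have hcard : Nat.card ({v}ᶜ : Set V) + 1 = Nat.card V := by
    have := Set.ncard_add_ncard_compl ({v} : Set V)
    rw [Set.ncard_singleton] at this
    rw [Nat.card_coe_set_eq]
    omega
  rw [isKonigEgervary_iff]
  let f : deleteVert G v ↪g G := Embedding.induce _
  constructor
  · rintro ⟨S, M, hS, hM, h⟩
    have hM' : (M.map f.toHom).IsMatching := hM.map f.toHom f.injective
    refine ⟨Subtype.val '' S, M.map f.toHom, ?_, hM', ?_, ?_, ?_⟩
    · apply isIndepSet_of_not_adj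
      rintro _ ⟨a, ha, rfl⟩ _ ⟨b, hb, rfl⟩ hab
      exact not_adj_of_isIndepSet hS a ha b hb (f.map_adj_iff.1 hab)
    · rintro ⟨a, -, ha⟩
      exact a.2 ha
    · rintro ⟨a, -, ha⟩
      exact a.2 ha
    · have h1 := ncard_verts_of_isMatching hM
      have h2 := ncard_verts_of_isMatching hM'
      have h3 : (M.map f.toHom).verts.ncard = M.verts.ncard :=
        Set.ncard_image_of_injective _ f.injective
      rw [Set.ncard_image_of_injective _ Subtype.val_injective]
      omega
  · rintro ⟨S, M, hS, hM, hvS, hvM, h⟩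
    have hM' : (M.comap f.toHom).IsMatching := by
      intro a ha
      obtain ⟨b, hb, hb'⟩ := hM ha
      have hbv : b ∈ ({v}ᶜ : Set V) := by
        rintro rfl
        exact hvM (M.edge_vert hb.symm)
      refine ⟨⟨b, hbv⟩, ⟨f.map_adj_iff.1 hb.adj_sub, hb⟩, ?_⟩
      intro c hc
      exact Subtype.ext (hb' _ hc.2)
    have himage : ∀ T : Set V, v ∉ T → (Subtype.val ⁻¹' T : Set ({v}ᶜ : Set V)).ncard = T.ncard := by
      intro T hT
      rw [← Set.ncard_image_of_injective _ Subtype.val_injective, Subtype.image_preimage_coe,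
        Set.inter_eq_right.2]
      rintro a ha rfl
      exact hT ha
    refine ⟨Subtype.val ⁻¹' S, M.comap f.toHom, ?_, hM', ?_⟩
    · apply isIndepSet_of_not_adj
      intro a ha b hb hab
      exact not_adj_of_isIndepSet hS _ ha _ hb (f.map_adj_iff.2 hab)
    · have h1 := ncard_verts_of_isMatching hM
      have h2 := ncard_verts_of_isMatching hM'
      have h3 := himage M.verts hvM
      have h4 : (M.comap f.toHom).verts = Subtype.val ⁻¹' M.verts := rfl
      rw [himage S hvS]
      rw [h4] at h2
      omega

/-- `core(G)`: the set of the vertices common to all maximum independent sets. -/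
def core (G : SimpleGraph V) : Set V :=
  ⋂₀ {S : Set V | G.IsIndepSet S ∧ S.ncard = G.indepNum}

/-- The set of the vertices that some maximum matching leaves unmatched. -/
def missable (G : SimpleGraph V) : Set V :=
  {v | ∃ M : G.Subgraph, M.IsMatching ∧ M.edgeSet.ncard = matchingNum G ∧ v ∉ M.verts}

/-- In a König–Egerváry graph the deficit of one vertex in `G - v` can be absorbed either by `α` or
by `μ`, and exactly one of them has to drop. -/
theorem isKonigEgervary_deleteVert_iff_core [Finite V] (hG : IsKonigEgervary G) :
    IsKonigEgervary (deleteVert G v) ↔ v ∉ core G ∨ v ∈ missable G := by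
  have hG' : G.indepNum + matchingNum G = Nat.card V := hG
  rw [isKonigEgervary_deleteVert_iff]
  constructor
  · rintro ⟨S, M, hS, hM, hvS, hvM, h⟩
    have h1 := ncard_le_indepNum hS
    have h2 := ncard_edgeSet_le_matchingNum hM
    by_cases hSc : S.ncard = G.indepNum
    · exact Or.inl fun hv => hvS (hv S ⟨hS, hSc⟩)
    · exact Or.inr ⟨M, hM, by omega, hvM⟩
  · rintro (hv | ⟨M, hM, hMc, hvM⟩)
    · simp only [core, Set.mem_sInter, not_forall] at hv
      obtain ⟨S, ⟨hS, hSc⟩, hvS⟩ := hv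
      obtain ⟨M, hM, hMc⟩ := exists_isMatching_ncard_eq_matchingNum G
      obtain ⟨M', hM', h1, h2⟩ := exists_isMatching_notMem_verts hM v
      exact ⟨S, M', hS, hM', hvS, h2, by omega⟩
    · obtain ⟨S, hS, hSc⟩ := exists_isIndepSet_ncard_eq_indepNum G
      refine ⟨S \ {v}, M, hS.mono Set.sdiff_subset, hM, by simp, hvM, ?_⟩
      have := Set.pred_ncard_le_ncard_sdiff_singleton S v
      omega

/-! ### The kernel -/

theorem nbhd_subset_compl_of_isIndepSet (hS : G.IsIndepSet S) {A : Set V} (hA : A ⊆ S) :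
    nbhd G A ⊆ Sᶜ := by
  rintro b ⟨a, hab, ha⟩ hb
  exact not_adj_of_isIndepSet hS b hb a (hA ha) hab

/-- A matching leaves at least `d(A)` vertices of `A` unmatched. -/
theorem diff_le_ncard_diff_verts [Finite V] (hM : M.IsMatching) (A : Set V) :
    diff G A ≤ ((A \ M.verts).ncard : ℤ) := by
  have h1 : (A ∩ M.verts).ncard ≤ (nbhd G A).ncard :=
    ncard_inter_verts_le_of_isMatching hM fun a ha b hab => ⟨a, hab.adj_sub.symm, ha⟩
  have h2 := Set.ncard_inter_add_ncard_sdiff_eq_ncard A M.verts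
  unfold diff
  omega

theorem ncard_compl_verts_of_isMatching [Finite V] (hM : M.IsMatching) :
    (M.vertsᶜ).ncard + 2 * M.edgeSet.ncard = Nat.card V := by
  rw [← ncard_verts_of_isMatching hM, add_comm, Set.ncard_add_ncard_compl]

theorem diff_le_critDiff [Finite V] (G : SimpleGraph V) (A : Set V) : diff G A ≤ critDiff G :=
  le_csSup (Set.finite_range (diff G)).bddAbove ⟨A, rfl⟩

theorem le_diff_of_subset_isIndepSet [Finite V] (hS : G.IsIndepSet S) :
    (S.ncard : ℤ) - (Sᶜ.ncard : ℤ) ≤ diff G S := by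
  have := Set.ncard_le_ncard (nbhd_subset_compl_of_isIndepSet hS subset_rfl)
  unfold diff
  omega

theorem critDiff_eq [Finite V] (hG : IsKonigEgervary G) :
    critDiff G = (G.indepNum : ℤ) - (matchingNum G : ℤ) := by
  have hG' : G.indepNum + matchingNum G = Nat.card V := hG
  obtain ⟨S, hS, hSc⟩ := exists_isIndepSet_ncard_eq_indepNum G
  obtain ⟨M, hM, hMc⟩ := exists_isMatching_ncard_eq_matchingNum G
  apply le_antisymm
  · refine csSup_le (Set.range_nonempty _) ?_
    rintro _ ⟨A, rfl⟩
    have h1 := diff_le_ncard_diff_verts hM A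
    have h2 : (A \ M.verts).ncard ≤ (M.vertsᶜ).ncard := Set.ncard_le_ncard fun a ha => ha.2
    have h3 := ncard_compl_verts_of_isMatching hM
    omega
  · have h1 := le_diff_of_subset_isIndepSet hS
    have h2 := diff_le_critDiff G S
    have h3 := Set.ncard_add_ncard_compl S
    omega

theorem isCriticalIndep_of_le_diff [Finite V] (hG : IsKonigEgervary G) (hS : G.IsIndepSet S)
    (h : (G.indepNum : ℤ) - (matchingNum G : ℤ) ≤ diff G S) : IsCriticalIndep G S :=
  ⟨hS, (diff_le_critDiff G S).antisymm (critDiff_eq hG ▸ h)⟩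

theorem isCriticalIndep_of_ncard_eq_indepNum [Finite V] (hG : IsKonigEgervary G)
    (hS : G.IsIndepSet S) (hSc : S.ncard = G.indepNum) : IsCriticalIndep G S := by
  refine isCriticalIndep_of_le_diff hG hS ((le_diff_of_subset_isIndepSet hS).trans' ?_)
  have hG' : G.indepNum + matchingNum G = Nat.card V := hG
  have h3 := Set.ncard_add_ncard_compl S
  omega

/-- A critical set has too few neighbours to leave out any vertex unmatched by a maximum
matching. -/
theorem missable_subset_ker [Finite V] (hG : IsKonigEgervary G) : missable G ⊆ ker G := by
  rintro v ⟨M, hM, hMc, hv⟩ A ⟨hA, hAd⟩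
  have hG' : G.indepNum + matchingNum G = Nat.card V := hG
  have h1 := diff_le_ncard_diff_verts hM A
  rw [hAd, critDiff_eq hG] at h1
  have h3 := ncard_compl_verts_of_isMatching hM
  have h4 : A \ M.verts = M.vertsᶜ :=
    Set.eq_of_subset_of_ncard_le (fun a ha => ha.2) (by omega)
  have h5 : v ∈ A \ M.verts := h4 ▸ hv
  exact h5.1

/-- If no maximum matching misses `v`, then, for a maximum independent set `S`, Hall's condition
fails for matching `Sᶜ` into `S \ {v}`. A violating set `Y ⊆ Sᶜ` yields the critical independent
set `(S \ {v}) \ N(Y)`, which avoids `v`. -/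
theorem ker_subset_missable [Finite V] (hG : IsKonigEgervary G) : ker G ⊆ missable G := by
  classical
  have := Fintype.ofFinite V
  intro v hv
  have hG' : G.indepNum + matchingNum G = Nat.card V := hG
  obtain ⟨S, hS, hSc⟩ := exists_isIndepSet_ncard_eq_indepNum G
  have hvS : v ∈ S := hv S (isCriticalIndep_of_ncard_eq_indepNum hG hS hSc)
  have hcompl := Set.ncard_add_ncard_compl S
  let t : (Sᶜ : Set V) → Finset V := fun y => {a | a ∈ S ∧ a ≠ v ∧ G.Adj y a}
  have hall : ∀ Y : Finset (Sᶜ : Set V), Y.card ≤ (Y.biUnion t).card := by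
    intro Y
    by_contra! hY
    set A : Set V := {a | a ∈ S ∧ a ≠ v ∧ a ∉ Y.biUnion t} with hA
    have hAS : A ⊆ S := fun a ha => ha.1
    refine (hv A (isCriticalIndep_of_le_diff hG (hS.mono hAS) ?_)).2.1 rfl
    have h1 : nbhd G A ⊆ Sᶜ \ (Subtype.val '' (Y : Set (Sᶜ : Set V))) := by
      intro b hb
      refine ⟨nbhd_subset_compl_of_isIndepSet hS hAS hb, ?_⟩
      rintro ⟨y, hy, rfl⟩
      obtain ⟨a, hya, ha⟩ := hb
      exact ha.2.2 (Finset.mem_biUnion.2 ⟨y, hy, by simpa [t] using ⟨ha.1, ha.2.1, hya⟩⟩)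
    have h2 := Set.ncard_le_ncard h1
    have h3 := Set.ncard_sdiff_add_ncard_of_subset
      (show Subtype.val '' (Y : Set (Sᶜ : Set V)) ⊆ Sᶜ by rintro _ ⟨y, -, rfl⟩; exact y.2)
    rw [Set.ncard_image_of_injective _ Subtype.val_injective, Set.ncard_coe_finset] at h3
    have h4 : S ⊆ A ∪ insert v (Y.biUnion t : Set V) := by
      intro a ha
      by_cases h : a = v ∨ a ∈ Y.biUnion t
      · exact Or.inr (h.imp id id)
      · exact Or.inl ⟨ha, fun h' => h (Or.inl h'), fun h' => h (Or.inr h')⟩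
    have h5 := (Set.ncard_le_ncard h4).trans (Set.ncard_union_le _ _)
    have h6 := Set.ncard_insert_le v (Y.biUnion t : Set V)
    rw [Set.ncard_coe_finset] at h6
    unfold diff
    omega
  obtain ⟨f, hf, hft⟩ := (Finset.all_card_le_biUnion_card_iff_exists_injective t).1 hall
  have hft' : ∀ y, f y ∈ S ∧ f y ≠ v ∧ G.Adj y (f y) := fun y => by simpa [t] using hft y
  have hdisj : Disjoint Sᶜ (Set.range f) := by
    rw [Set.disjoint_left]
    rintro _ h ⟨y, rfl⟩
    exact h (hft' y).1
  obtain ⟨M, hMv, hM⟩ := Subgraph.IsMatching.exists_of_disjoint_sets_of_equiv hdisj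
    (Equiv.ofInjective f hf) fun y => (hft' y).2.2
  refine ⟨M, hM, ?_, ?_⟩
  · have h1 := ncard_verts_of_isMatching hM
    rw [hMv, Set.ncard_union_eq hdisj, Set.ncard_range_of_injective hf, Nat.card_coe_set_eq] at h1
    omega
  · rw [hMv]
    rintro (h | ⟨y, hy⟩)
    · exact h hvS
    · exact (hft' y).2.1 hy

theorem ker_eq_missable [Finite V] (hG : IsKonigEgervary G) : ker G = missable G :=
  (ker_subset_missable hG).antisymm (missable_subset_ker hG)

theorem ker_subset_core [Finite V] (hG : IsKonigEgervary G) : ker G ⊆ core G :=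
  fun _ hv S hS => hv S (isCriticalIndep_of_ncard_eq_indepNum hG hS.1 hS.2)

theorem rhoV_add_ncard_core [Finite V] (hG : IsKonigEgervary G) :
    rhoV G + (core G).ncard = Nat.card V + epsilon G := by
  have h : {v | IsKonigEgervary (deleteVert G v)} = (core G \ ker G)ᶜ := by
    ext v
    rw [Set.mem_ofPred_eq, isKonigEgervary_deleteVert_iff_core hG, ker_eq_missable hG]
    simp only [Set.mem_compl_iff, Set.mem_sdiff]
    tauto
  have h1 := Set.ncard_add_ncard_compl (core G \ ker G)
  have h2 := Set.ncard_sdiff_add_ncard_of_subset (ker_subset_core hG)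
  unfold rhoV epsilon
  rw [h]
  omega

/-- The core contains every vertex left unmatched by a maximum matching. -/
theorem indepNum_le_matchingNum_add_ncard_core [Finite V] (hG : IsKonigEgervary G) :
    G.indepNum ≤ matchingNum G + (core G).ncard := by
  have hG' : G.indepNum + matchingNum G = Nat.card V := hG
  obtain ⟨M, hM, hMc⟩ := exists_isMatching_ncard_eq_matchingNum G
  have h1 : M.vertsᶜ ⊆ core G := fun v hv =>
    ker_subset_core hG (missable_subset_ker hG ⟨M, hM, hMc, hv⟩)
  have h2 := Set.ncard_le_ncard h1
  have h3 := ncard_compl_verts_of_isMatching hM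
  omega

/-! ### Critical edges -/

/-- An independent set of `G - xy` with more than `α(G)` elements contains both ends of `xy`, and
becomes a maximum independent set of `G` when either end is dropped. -/
theorem IsAlphaCritical.exists_set [Finite V] (h : IsAlphaCritical G s(x, y)) :
    ∃ T : Set V, (G.deleteEdges {s(x, y)}).IsIndepSet T ∧ T.ncard = G.indepNum + 1 ∧
      (G.IsIndepSet (T \ {x}) ∧ (T \ {x}).ncard = G.indepNum) ∧
      (G.IsIndepSet (T \ {y}) ∧ (T \ {y}).ncard = G.indepNum) := by
  obtain ⟨T, hT, hTc⟩ := exists_isIndepSet_ncard_eq_indepNum (G.deleteEdges {s(x, y)})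
  have hT' : ∀ a ∈ T, ∀ b ∈ T, G.Adj a b → s(a, b) = s(x, y) := by
    intro a ha b hb hab
    by_contra hne
    exact not_adj_of_isIndepSet hT a ha b hb (deleteEdges_adj.2 ⟨hab, hne⟩)
  have hx : G.IsIndepSet (T \ {x}) := isIndepSet_of_not_adj fun a ha b hb hab => by
    rcases Sym2.eq_iff.1 (hT' a ha.1 b hb.1 hab) with ⟨h1, -⟩ | ⟨-, h1⟩
    · exact ha.2 h1
    · exact hb.2 h1
  have hy : G.IsIndepSet (T \ {y}) := isIndepSet_of_not_adj fun a ha b hb hab => by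
    rcases Sym2.eq_iff.1 (hT' a ha.1 b hb.1 hab) with ⟨-, h1⟩ | ⟨h1, -⟩
    · exact hb.2 h1
    · exact ha.2 h1
  have h1 := ncard_le_indepNum hx
  have h2 := ncard_le_indepNum hy
  have h3 := Set.pred_ncard_le_ncard_sdiff_singleton T x
  have h4 := Set.pred_ncard_le_ncard_sdiff_singleton T y
  have h5 := h.2
  exact ⟨T, hT, by omega, ⟨hx, by omega⟩, ⟨hy, by omega⟩⟩

theorem IsAlphaCritical.notMem_core [Finite V] (h : IsAlphaCritical G s(x, y)) :
    x ∉ core G ∧ y ∉ core G := by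
  obtain ⟨T, -, -, hx, hy⟩ := h.exists_set
  exact ⟨fun hc => (hc _ hx).2 rfl, fun hc => (hc _ hy).2 rfl⟩

/-- Otherwise a maximum matching of `G` and an independent set of `G - xy` with `α(G) + 1` elements
would contradict weak duality in `G - xy`. -/
theorem IsAlphaCritical.adj_of_isMatching [Finite V] (hG : IsKonigEgervary G)
    (h : IsAlphaCritical G s(x, y)) (hM : M.IsMatching)
    (hMc : M.edgeSet.ncard = matchingNum G) : M.Adj x y := by
  have hG' : G.indepNum + matchingNum G = Nat.card V := hG
  obtain ⟨T, hT, hTc, -, -⟩ := h.exists_set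
  by_contra hxy
  have h1 : T.ncard + M.edgeSet.ncard ≤ (T ∪ M.verts).ncard := by
    refine ncard_add_ncard_edgeSet_le hM fun a ha b hb hab => ?_
    refine not_adj_of_isIndepSet hT a ha b hb (deleteEdges_adj.2 ⟨hab.adj_sub, fun he => hxy ?_⟩)
    rcases Sym2.eq_iff.1 he with ⟨rfl, rfl⟩ | ⟨rfl, rfl⟩
    · exact hab
    · exact hab.symm
  have h2 := Set.ncard_le_card (T ∪ M.verts)
  omega

/-- An edge of a maximum matching meets each maximum independent set of a König–Egerváry graph:
otherwise deleting its two ends would violate weak duality. -/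
theorem mem_or_mem_of_adj_of_isMatching [Finite V] (hG : IsKonigEgervary G)
    (hS : G.IsIndepSet S) (hSc : S.ncard = G.indepNum) (hM : M.IsMatching)
    (hMc : M.edgeSet.ncard = matchingNum G) (hxy : M.Adj x y) : x ∈ S ∨ y ∈ S := by
  have hG' : G.indepNum + matchingNum G = Nat.card V := hG
  by_contra! hno
  obtain ⟨M', hM', h1, hx, hy⟩ := exists_isMatching_deleteVerts_pair hM hxy
  have h2 := ncard_add_ncard_edgeSet_le_of_isIndepSet hS hM'
  have h3 : S ∪ M'.verts ⊆ ({x, y} : Set V)ᶜ := by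
    rintro a (ha | ha) (rfl | rfl)
    exacts [hno.1 ha, hno.2 ha, hx ha, hy ha]
  have h4 := Set.ncard_le_ncard h3
  have h5 := Set.ncard_add_ncard_compl ({x, y} : Set V)
  rw [Set.ncard_pair hxy.ne] at h5
  omega

/-- Each critical edge is sent to an end of it in a fixed maximum independent set `S`. These ends
lie outside the core, and they are distinct because all critical edges lie in one matching. -/
theorem eta_add_ncard_core_le [Finite V] (hG : IsKonigEgervary G) :
    eta G + (core G).ncard ≤ G.indepNum := by
  obtain ⟨S, hS, hSc⟩ := exists_isIndepSet_ncard_eq_indepNum G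
  obtain ⟨M, hM, hMc⟩ := exists_isMatching_ncard_eq_matchingNum G
  have hend : ∀ e : Sym2 V, ∃ a, IsAlphaCritical G e →
      ∃ b, e = s(a, b) ∧ M.Adj a b ∧ a ∈ S \ core G := by
    intro e
    induction e using Sym2.ind with | _ x y
    by_cases he : IsAlphaCritical G s(x, y)
    · have hadj := he.adj_of_isMatching hG hM hMc
      have hcore := he.notMem_core
      rcases mem_or_mem_of_adj_of_isMatching hG hS hSc hM hMc hadj with h | h
      · exact ⟨x, fun _ => ⟨y, rfl, hadj, h, hcore.1⟩⟩
      · exact ⟨y, fun _ => ⟨x, Sym2.eq_swap, hadj.symm, h, hcore.2⟩⟩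
    · exact ⟨x, fun h => absurd h he⟩
  choose f hf using hend
  have h1 : eta G ≤ (S \ core G).ncard := by
    refine Set.ncard_le_ncard_of_injOn f ?_ ?_
    · intro e he
      obtain ⟨b, -, -, h⟩ := hf e he
      exact h
    · intro e he e' he' hee'
      obtain ⟨b, hb, hab, -⟩ := hf e he
      obtain ⟨b', hb', hab', -⟩ := hf e' he'
      rw [← hee'] at hb' hab'
      rw [hb, hb', hM.eq_of_adj_left hab hab']
  have h2 := Set.ncard_sdiff_add_ncard_of_subset (show core G ⊆ S from fun a ha => ha S ⟨hS, hSc⟩)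
  omega

end KonigEgervary

theorem mainTheorem9 {V : Type*} [Finite V] (G : SimpleGraph V)
    (hG : KonigEgervary.IsKonigEgervary G) :
    (KonigEgervary.eta G + KonigEgervary.matchingNum G + KonigEgervary.epsilon G
        ≤ KonigEgervary.rhoV G) ∧
    (KonigEgervary.rhoV G
        ≤ 2 * KonigEgervary.matchingNum G + KonigEgervary.epsilon G) ∧
    ((KonigEgervary.eta G + KonigEgervary.matchingNum G + KonigEgervary.epsilon G
          = KonigEgervary.rhoV G ∧
      KonigEgervary.rhoV G
          = 2 * KonigEgervary.matchingNum G + KonigEgervary.epsilon G) ↔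
      KonigEgervary.eta G = KonigEgervary.matchingNum G) := by
  have hG' : G.indepNum + KonigEgervary.matchingNum G = Nat.card V := hG
  have h1 := KonigEgervary.rhoV_add_ncard_core hG
  have h2 := KonigEgervary.indepNum_le_matchingNum_add_ncard_core hG
  have h3 := KonigEgervary.eta_add_ncard_core_le hG
  omega
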